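/- Let $X$ be a standard Borel space and let $\mathcal R$ be a Borel equivalence relation on $X$ (that is, $\mathcal R$ is a Borel subset of $X\times X$) all of whose classes are countable. Let $\mathcal R_1,\mathcal R_2$ be Borel subrelations of $\mathcal R$ (equivalence relations on $X$), and let $\mathcal R_3$ be a Borel equivalence relation on $X$ contained in $\mathcal R_1$ and in $\mathcal R_2$. For $n\ge 2$, call an $n$-tuple $(x_1,\dots,x_n)$ of points of $X$ reduced if - each pair $(x_i,x_{i+1})$, $1\le i\le n-1$, belongs to $\mathcal R_1$ or to $\mathcal R_2$, and for no $j\in\{1,2\}$ do two successive pairs $(x_i,x_{i+1})$, $(x_{i+1},x_{i+2})$ both belong to $\mathcal R_j$; - if $n>2$, no pair $(x_i,x_{i+1})$ belongs to $\mathcal R_3$; - if $n=2$, $x_1\ne x_2$. Suppose that $\mathcal R=\mathcal R_1\star_{\mathcal R_3}\mathcal R_2$ is the amalgamated product of $\mathcal R_1$ and $\mathcal R_2$ over $\mathcal R_3$: $\mathcal R$ is the smallest equivalence relation containing $\mathcal R_1$ and $\mathcal R_2$, and $x_n\ne x_1$ for every reduced tuple $(x_1,\dots,x_n)$. Let $[[\mathcal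 R]]$ be the full pseudogroup of $\mathcal R$: the set of all Borel isomorphisms $\phi:A\to B$ between Borel subsets of $X$ such that $(x,\phi(x))\in\mathcal R$ for all $x\in A$. For $\phi:A\to B$ in $[[\mathcal R]]$ and $i\in\{1,2\}$, let $\phi^{-1}\mathcal R_i\phi$ be the equivalence relation on $A$ for which $x$ and $y$ are equivalent if $(\phi(x),\phi(y))\in\mathcal R_i$. A Borel equivalence relation on a standard Borel space is smooth if some Borel set meets each of its classes in exactly one point. Let $\mathcal S\subseteq\mathcal R$ be a Borel equivalence relation on $X$ such that, for every $\phi:A\to B$ in $[[\mathcal R]]$, the equivalence relations $\phi^{-1}\mathcal R_1\phi\cap\mathcal S$ and $\phi^{-1}\mathcal R_2\phi\cap\mathcal S$ on $A$ are smooth. Then $\mathcal S$ is treeable: there is a Borel, symmetric, irreflexive subset of $X\times X$ that, viewed as a graph on $X$, has no cycles and has the classes of $\mathcal S$ as its connected components. -/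

import Mathlib

namespace BorelRel

/-- The equivalence relation `R` on `X` is Borel: its graph is a Borel subset of `X × X`. -/
def IsBorel {X : Type*} [MeasurableSpace X] (R : Setoid X) : Prop :=
  MeasurableSet {p : X × X | R p.1 p.2}

/-- Every equivalence class of `R` is countable. -/
def HasCountableClasses {X : Type*} (R : Setoid X) : Prop :=
  ∀ x : X, {y : X | R x y}.Countable

/-- `R` is smooth: it has a (Borel) fundamental domain, i.e. a Borel set that meets every
class of `R` in exactly one point. -/
def IsSmooth {X : Type*} [MeasurableSpace X] (R : Setoid X) : Prop :=
  ∃ D : Set X, MeasurableSet D ∧ ∀ x : X, ∃! y : X, y ∈ D ∧ R x y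

/-- `φ` is an element of the full pseudogroup `[[R]]`: a Borel isomorphism from a Borel subset
`φ.source` of `X` onto a Borel subset `φ.target` of `X` whose graph is contained in `R`.
(The values of `φ` off its source and of its inverse off its target play no role.) -/
structure MemFullPseudogroup {X : Type*} [MeasurableSpace X] (R : Setoid X)
    (φ : PartialEquiv X X) : Prop where
  measurableSet_source : MeasurableSet φ.source
  measurableSet_target : MeasurableSet φ.target
  measurable_toFun : Measurable (φ.source.domRestrict φ)
  measurable_invFun : Measurable (φ.target.domRestrict φ.symm)
  graph_subset : ∀ x ∈ φ.source, R x (φ x)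

/-- The relation `φ⁻¹ Q φ` on the domain of `φ`: two points `x`, `y` of `φ.source` are equivalent
if `φ x` and `φ y` are `Q`-equivalent. -/
def conj {X : Type*} (φ : PartialEquiv X X) (Q : Setoid X) : Setoid φ.source :=
  Q.comap (φ.source.domRestrict φ)

/-- The restriction of `S` to the subset `A`. -/
def restrict {X : Type*} (S : Setoid X) (A : Set X) : Setoid A :=
  S.comap Subtype.val

/-- The `n`-tuple `(x 1, …, x n)`, with `2 ≤ n`, is reduced with respect to `R₁`, `R₂` and their
common subrelation `R₃`. (Only the values of `x` at `1, …, n` matter.) -/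
structure IsReduced {X : Type*} (R₁ R₂ R₃ : Setoid X) (n : ℕ) (x : ℕ → X) : Prop where
  two_le : 2 ≤ n
  pair : ∀ i : ℕ, 1 ≤ i → i + 1 ≤ n → R₁ (x i) (x (i + 1)) ∨ R₂ (x i) (x (i + 1))
  not_both₁ : ∀ i : ℕ, 1 ≤ i → i + 2 ≤ n →
    ¬ (R₁ (x i) (x (i + 1)) ∧ R₁ (x (i + 1)) (x (i + 2)))
  not_both₂ : ∀ i : ℕ, 1 ≤ i → i + 2 ≤ n →
    ¬ (R₂ (x i) (x (i + 1)) ∧ R₂ (x (i + 1)) (x (i + 2)))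
  not_common : 2 < n → ∀ i : ℕ, 1 ≤ i → i + 1 ≤ n → ¬ R₃ (x i) (x (i + 1))
  ne_of_two : n = 2 → x 1 ≠ x 2

/-- `R` is the amalgamated product of `R₁` and `R₂` over their common subrelation `R₃`:
`R` is generated by `R₁` and `R₂` (it is the smallest equivalence relation containing both),
and no reduced tuple is closed. -/
structure IsAmalgam {X : Type*} (R R₁ R₂ R₃ : Setoid X) : Prop where
  le₁ : R₃ ≤ R₁
  le₂ : R₃ ≤ R₂
  generated : R = R₁ ⊔ R₂
  reduced_not_closed : ∀ (n : ℕ) (x : ℕ → X), IsReduced R₁ R₂ R₃ n x → x n ≠ x 1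

/-- `R` is treeable: there is a Borel graph on `X` (symmetric and off the diagonal) without cycles
whose connected components are exactly the classes of `R`; so every class is given the
structure of a tree. -/
def IsTreeable {X : Type*} [MeasurableSpace X] (R : Setoid X) : Prop :=
  ∃ G : SimpleGraph X, MeasurableSet {p : X × X | G.Adj p.1 p.2} ∧ G.IsAcyclic ∧
    ∀ x y : X, G.Reachable x y ↔ R x y

end BorelRel

/-! The classes of `R₁` and `R₂` are the vertices of a Bass–Serre graph, in which each point joins
its two classes. A cycle would spell a closed reduced tuple, so the graph is a forest
(`bassSerre_isAcyclic`). Since `R₁` and `R₂` generate `R`, the vertices inside one `R`-class are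
connected. Every point is moreover attached as a leaf to its `R₁`-class.

Fix a class `C` of `S`. The class-vertices of the tree around `C`, together with the leaves of `C`,
are partitioned into connected parts, each containing exactly one leaf of `C`. Contracting the parts
turns `C` into a tree (`isAcyclic_of_contraction`, `IsStep.treeing_reachable_iff`). The parts come
from a rule that moves each vertex towards the `R₁`-classes meeting `C` and finally out to a leaf of
`C`.

The rule has to be Borel and to depend only on `C` and the vertex, not on the points naming them;
this is where smoothness enters. Countably many partial maps in the pseudogroup cover `R`, and their
transversals yield a Borel choice of a point of `C` from `C` and an `R₁`- or `R₂`-class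
(`IsEnumeration.exists_selector`). From this base point, an enumeration of the `R`-classes by Borel
functions (Lusin–Novikov) picks the first admissible next point (`IsEnumeration.exists_isStep`). -/

namespace BorelRel

open Set Filter Topology

/-! ### Lusin–Novikov uniformization for countable sections -/

section LusinNovikov

variable {X Y : Type*} [MeasurableSpace X] [MeasurableSpace Y]

/-- A set of pairs that is the graph of a partial function. -/
def IsGraph {X Y : Type*} (G : Set (X × Y)) : Prop :=
  ∀ x y y', (x, y) ∈ G → (x, y') ∈ G → y = y'

/-- A set of pairs that is covered by countably many Borel graphs of partial functions. -/
def IsSmall (A : Set (X × Y)) : Prop :=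
  ∃ 𝒢 : Set (Set (X × Y)), 𝒢.Countable ∧ (∀ G ∈ 𝒢, MeasurableSet G ∧ IsGraph G) ∧ A ⊆ ⋃₀ 𝒢

theorem IsSmall.mono {A B : Set (X × Y)} (hB : IsSmall B) (h : A ⊆ B) : IsSmall A := by
  obtain ⟨𝒢, h1, h2, h3⟩ := hB
  exact ⟨𝒢, h1, h2, h.trans h3⟩

theorem IsSmall.iUnion {ι : Type*} [Countable ι] {A : ι → Set (X × Y)}
    (h : ∀ i, IsSmall (A i)) : IsSmall (⋃ i, A i) := by
  choose 𝒢 h1 h2 h3 using h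
  refine ⟨⋃ i, 𝒢 i, countable_iUnion h1, ?_, ?_⟩
  · intro G hG
    obtain ⟨i, hi⟩ := mem_iUnion.1 hG
    exact h2 i G hi
  · refine iUnion_subset fun i => (h3 i).trans ?_
    exact sUnion_subset_sUnion (subset_iUnion 𝒢 i)

theorem IsSmall.empty : IsSmall (∅ : Set (X × Y)) :=
  ⟨∅, countable_empty, by simp, by simp⟩

theorem IsSmall.union {A B : Set (X × Y)} (hA : IsSmall A) (hB : IsSmall B) :
    IsSmall (A ∪ B) := by
  rw [union_eq_iUnion]
  exact IsSmall.iUnion fun b => by cases b <;> assumption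

/-- There is a Borel cover `B` of `X` such that each `A i` is small over `B i`. -/
def IsSeparable {ι : Type*} (A : ι → Set (X × Y)) : Prop :=
  ∃ B : ι → Set X, (∀ i, MeasurableSet (B i)) ∧ (∀ x, ∃ i, x ∈ B i) ∧
    ∀ i, IsSmall (A i ∩ Prod.fst ⁻¹' B i)

theorem IsSeparable.of_comp {ι κ : Type*} [Countable ι] (f : ι → κ) {A : κ → Set (X × Y)}
    (h : IsSeparable (A ∘ f)) : IsSeparable A := by
  obtain ⟨B, h1, h2, h3⟩ := h
  refine ⟨fun k => ⋃ i : {i // f i = k}, B i, fun k => MeasurableSet.iUnion fun i => h1 i, ?_, ?_⟩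
  · intro x
    obtain ⟨i, hi⟩ := h2 x
    exact ⟨f i, mem_iUnion.2 ⟨⟨i, rfl⟩, hi⟩⟩
  · intro k
    rw [preimage_iUnion, inter_iUnion]
    refine IsSmall.iUnion fun i => ?_
    obtain ⟨i, rfl⟩ := i
    exact h3 i

/-- Separability of all the choices `c` would pass to `A`. If `x` lies in no `⋂ k, ⋃ c, B c i`, the
failing indices `k` assemble into one choice `c` whose sets `B c i` all miss `x`. Finiteness of `ι`
leaves only countably many choices. -/
theorem exists_refinement {ι κ : Type*} [Finite ι] [Countable κ] {A : ι → Set (X × Y)}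
    {A' : ι → κ → Set (X × Y)} (hA : ∀ i, A i ⊆ ⋃ k, A' i k) (hbad : ¬ IsSeparable A) :
    ∃ c : ι → κ, ¬ IsSeparable fun i => A' i (c i) := by
  by_contra! hcon
  apply hbad
  choose B h1 h2 h3 using hcon
  refine ⟨fun i => ⋂ k, ⋃ c : {c : ι → κ // c i = k}, B c i,
    fun i => MeasurableSet.iInter fun k => MeasurableSet.iUnion fun c => h1 _ _, ?_, ?_⟩
  · intro x
    by_contra! hx
    simp only [mem_iInter, not_forall, mem_iUnion, not_exists] at hx
    choose c hc using hx
    obtain ⟨i, hi⟩ := h2 c x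
    exact hc i ⟨c, rfl⟩ hi
  · intro i
    have : IsSmall (⋃ c : ι → κ, A' i (c i) ∩ Prod.fst ⁻¹' B c i) :=
      IsSmall.iUnion fun c => h3 c i
    refine this.mono ?_
    rintro ⟨x, y⟩ ⟨hxA, hx⟩
    obtain ⟨k, hk⟩ := mem_iUnion.1 (hA i hxA)
    obtain ⟨⟨c, rfl⟩, hc⟩ := mem_iUnion.1 (mem_iInter.1 hx k)
    exact mem_iUnion.2 ⟨c, hk, hc⟩

/-- Only countably many pairs of disjoint basic open sets need testing. If each choice of pairs gave
a separable family, what these families leave uncovered would be a Borel graph, because two distinct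
points of a section are separated by one of the pairs. -/
theorem exists_splitting {ι : Type*} [Finite ι] [TopologicalSpace Y] [T2Space Y]
    [SecondCountableTopology Y] [BorelSpace Y] {A : ι → Set (X × Y)} (hbad : ¬ IsSeparable A) :
    ∃ U : ι → Bool → Set Y, (∀ i b, IsOpen (U i b)) ∧ (∀ i, Disjoint (U i true) (U i false)) ∧
      ¬ IsSeparable fun p : ι × Bool => A p.1 ∩ Prod.snd ⁻¹' U p.1 p.2 := by
  by_contra! hcon
  apply hbad
  let K := {p : (TopologicalSpace.countableBasis Y) × (TopologicalSpace.countableBasis Y) //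
    Disjoint (p.1 : Set Y) (p.2 : Set Y)}
  let V : K → Bool → Set Y := fun k b => if b then k.1.1 else k.1.2
  have hV : ∀ k b, IsOpen (V k b) := by
    intro k b
    cases b
    · exact TopologicalSpace.isOpen_of_mem_countableBasis k.1.2.2
    · exact TopologicalSpace.isOpen_of_mem_countableBasis k.1.1.2
  have hsep := fun e : ι → K => hcon (fun i b => V (e i) b) (fun i b => hV _ _) (fun i => (e i).2)
  choose B h1 h2 h3 using hsep
  let C : ι → Set X := fun i => ⋂ k, ⋃ c : {c : ι → K // c i = k}, ⋃ b, B c (i, b)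
  have hC : ∀ i, MeasurableSet (C i) := fun i =>
    MeasurableSet.iInter fun k => MeasurableSet.iUnion fun c => MeasurableSet.iUnion fun b => h1 _ _
  refine ⟨C, hC, ?_, ?_⟩
  · intro x
    by_contra! hx
    simp only [C, mem_iInter, not_forall, mem_iUnion, not_exists] at hx
    choose c hc using hx
    obtain ⟨⟨i, b⟩, hi⟩ := h2 c x
    exact hc i ⟨c, rfl⟩ b hi
  · intro i
    let N : Set (X × Y) := ⋃ c : ι → K, ⋃ b, B c (i, b) ×ˢ V (c i) b
    have hN : MeasurableSet N := MeasurableSet.iUnion fun c => MeasurableSet.iUnion fun b =>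
      (h1 _ _).prod (hV _ _).measurableSet
    -- The uncovered part over `C i`, cut out by `N` rather than by `A i` so that it is Borel
    -- although `A i` need not be.
    let E : Set (X × Y) := (Prod.fst ⁻¹' C i) \ N
    have hE : MeasurableSet E := (measurable_fst (hC i)).diff hN
    have hEg : IsGraph E := by
      intro x y y' hy hy'
      by_contra hne
      obtain ⟨u, v, hu, hv, hyu, hyv, huv⟩ := t2_separation hne
      have hb := TopologicalSpace.isBasis_countableBasis Y
      obtain ⟨u', hu', hyu', huu'⟩ := hb.exists_subset_of_mem_open hyu hu
      obtain ⟨v', hv', hyv', hvv'⟩ := hb.exists_subset_of_mem_open hyv hv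
      let k : K := ⟨(⟨u', hu'⟩, ⟨v', hv'⟩), huv.mono huu' hvv'⟩
      have hxC : x ∈ C i := hy.1
      obtain ⟨⟨c, hck⟩, hc⟩ := mem_iUnion.1 (mem_iInter.1 hxC k)
      obtain ⟨b, hb⟩ := mem_iUnion.1 hc
      cases b
      · refine hy'.2 (mem_iUnion.2 ⟨c, mem_iUnion.2 ⟨false, hb, ?_⟩⟩)
        rw [hck]; exact hyv'
      · refine hy.2 (mem_iUnion.2 ⟨c, mem_iUnion.2 ⟨true, hb, ?_⟩⟩)
        rw [hck]; exact hyu'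
    have hEs : IsSmall E := ⟨{E}, countable_singleton E, by simpa using ⟨hE, hEg⟩, by simp⟩
    have hrest : IsSmall (⋃ c : ι → K, ⋃ b,
        (A i ∩ Prod.snd ⁻¹' V (c i) b) ∩ Prod.fst ⁻¹' B c (i, b)) :=
      IsSmall.iUnion fun c => IsSmall.iUnion fun b => h3 c (i, b)
    refine (hEs.union hrest).mono ?_
    rintro ⟨x, y⟩ ⟨hA, hx⟩
    by_cases hn : (x, y) ∈ N
    · right
      obtain ⟨c, hc⟩ := mem_iUnion.1 hn
      obtain ⟨b, hb⟩ := mem_iUnion.1 hc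
      exact mem_iUnion.2 ⟨c, mem_iUnion.2 ⟨b, ⟨hA, hb.2⟩, hb.1⟩⟩
    · exact Or.inl ⟨hx, hn⟩

/-- One level of the Cantor scheme: split by second coordinates, then pass to small basic open sets.
The second move keeps inseparability by `exists_refinement`. -/
theorem exists_shrinking {ι Z : Type*} [Finite ι] [TopologicalSpace Y] [T2Space Y]
    [SecondCountableTopology Y] [BorelSpace Y] [MetricSpace Z] [SecondCountableTopology Z]
    {g : Z → X × Y} (hg : Continuous fun z => (g z).2) {W : ι → Set Z}
    (hW : ∀ i, IsOpen (W i)) (hbad : ¬ IsSeparable fun i => g '' W i) {ε : ENNReal} (hε : 0 < ε) :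
    ∃ W' : ι → Bool → Set Z, (∀ i b, IsOpen (W' i b)) ∧ (∀ i b, closure (W' i b) ⊆ W i) ∧
      (∀ i b, Metric.ediam (W' i b) ≤ ε) ∧
      (∀ i, ∀ z ∈ W' i true, ∀ z' ∈ W' i false, (g z).2 ≠ (g z').2) ∧
      ¬ IsSeparable fun p : ι × Bool => g '' W' p.1 p.2 := by
  obtain ⟨U, hU, hUd, hUbad⟩ := exists_splitting hbad
  let O : ι × Bool → Set Z := fun p => W p.1 ∩ (fun z => (g z).2) ⁻¹' U p.1 p.2
  have hO : ∀ p, IsOpen (O p) := fun p => (hW _).inter ((hU _ _).preimage hg)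
  classical
  let T : ι × Bool → TopologicalSpace.countableBasis Z → Set Z := fun p k =>
    if closure (k : Set Z) ⊆ O p ∧ Metric.ediam (k : Set Z) ≤ ε then k else ∅
  have hcov : ∀ p, O p ⊆ ⋃ k, T p k := by
    intro p z hz
    obtain ⟨r, hr, hrO⟩ := EMetric.isOpen_iff.1 (hO p) z hz
    have hb := TopologicalSpace.isBasis_countableBasis Z
    let δ : ENNReal := min (r / 2) (ε / 2)
    have hδ : 0 < δ := lt_min (ENNReal.half_pos hr.ne') (ENNReal.half_pos hε.ne')
    obtain ⟨k, hk, hzk, hkb⟩ := hb.exists_subset_of_mem_open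
      (Metric.mem_eball_self (x := z) hδ) Metric.isOpen_eball
    refine mem_iUnion.2 ⟨⟨k, hk⟩, ?_⟩
    have hcond : closure (k : Set Z) ⊆ O p ∧ Metric.ediam (k : Set Z) ≤ ε := by
      constructor
      · by_cases hrt : r = ⊤
        · subst hrt
          exact (subset_univ _).trans ((by simp) : univ ⊆ Metric.eball z ⊤) |>.trans hrO
        refine Subset.trans ?_ hrO
        refine (closure_mono hkb).trans ?_
        intro w hw
        have h1 : w ∈ Metric.closedEBall z δ :=
          Metric.isClosed_closedEBall.closure_subset_iff.2 Metric.eball_subset_closedEBall hw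
        exact lt_of_le_of_lt (h1.trans (min_le_left _ _)) (ENNReal.half_lt_self hr.ne' hrt)
      · refine (Metric.ediam_mono hkb).trans (Metric.ediam_eball_le.trans ?_)
        calc 2 * δ ≤ 2 * (ε / 2) := by gcongr; exact min_le_right _ _
          _ = ε := ENNReal.mul_div_cancel (by simp) (by simp)
    simp only [T, hcond, and_self, if_true]
    exact hzk
  have hbad' : ¬ IsSeparable fun p : ι × Bool => g '' O p := by
    convert hUbad using 3 with p
    simp only [O]
    rw [← image_inter_preimage]
    rfl
  obtain ⟨c, hc⟩ := exists_refinement (A' := fun p k => g '' T p k)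
    (fun p => by rw [← image_iUnion]; exact image_mono (hcov p)) hbad'
  have hTO : ∀ p k, closure (T p k) ⊆ O p := by
    intro p k
    by_cases h : closure (k : Set Z) ⊆ O p ∧ Metric.ediam (k : Set Z) ≤ ε
    · simp only [T, h, and_self, if_true]
    · simp only [T, if_neg h, closure_empty, empty_subset]
  refine ⟨fun i b => T (i, b) (c (i, b)), ?_, ?_, ?_, ?_, hc⟩
  · intro i b
    by_cases h : closure (c (i, b) : Set Z) ⊆ O (i, b) ∧ Metric.ediam (c (i, b) : Set Z) ≤ ε
    · simp only [T, h, and_self, if_true]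
      exact TopologicalSpace.isOpen_of_mem_countableBasis (c (i, b)).2
    · simp only [T, if_neg h, isOpen_empty]
  · exact fun i b => (hTO _ _).trans inter_subset_left
  · intro i b
    by_cases h : closure (c (i, b) : Set Z) ⊆ O (i, b) ∧ Metric.ediam (c (i, b) : Set Z) ≤ ε
    · simp only [T, h, and_self, if_true]
    · simp only [T, if_neg h, Metric.ediam_empty, zero_le]
  · intro i z hz z' hz' heq
    have h1 := (hTO _ _ (subset_closure hz)).2
    have h2 := (hTO _ _ (subset_closure hz')).2
    refine Set.disjoint_left.1 (hUd i) h1 ?_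
    change (g z).2 ∈ U i false
    rw [heq]
    exact h2

/-- A Cantor scheme of open sets is built in `Z`, with every level inseparable. Along two branches
the first coordinates agree, since otherwise an open set would separate two pieces of some level.
The second coordinates differ, since sibling pieces have disjoint second projections. All branches
thus land in a single section. -/
theorem exists_uncountable_section {Z : Type*} [TopologicalSpace X] [T2Space X] [BorelSpace X]
    [TopologicalSpace Y] [T2Space Y]
    [SecondCountableTopology Y] [BorelSpace Y] [MetricSpace Z] [CompleteSpace Z]
    [SecondCountableTopology Z]
    {g : Z → X × Y} (hg : Continuous g) (hbad : ¬ IsSmall (range g)) :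
    ∃ x, ¬ {y | (x, y) ∈ range g}.Countable := by
  -- Only the values of `V` on lists of length `n` matter. New bits are added at the head, as in
  -- `PiNat.res`.
  let St : ℕ → Type _ := fun n => {V : List Bool → Set Z //
    (∀ l : List.Vector Bool n, IsOpen (V l.1)) ∧
      ¬ IsSeparable fun l : List.Vector Bool n => g '' V l.1}
  have hg2 : Continuous fun z => (g z).2 := continuous_snd.comp hg
  have step : ∀ n (V : St n), ∃ V' : St (n + 1), ∀ l : List Bool, l.length = n →
      (∀ b, closure (V'.1 (b :: l)) ⊆ V.1 l) ∧ (∀ b, Metric.ediam (V'.1 (b :: l)) ≤ (2⁻¹) ^ n) ∧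
      (∀ z ∈ V'.1 (true :: l), ∀ z' ∈ V'.1 (false :: l), (g z).2 ≠ (g z').2) := by
    rintro n ⟨V, hVo, hVbad⟩
    obtain ⟨W, w1, w2, w3, w4, w5⟩ := exists_shrinking hg2 hVo hVbad
      (ε := (2⁻¹) ^ n) (ENNReal.pow_pos (by simp) n)
    let V' : List Bool → Set Z := fun l => match l with
      | [] => ∅
      | b :: l => if h : l.length = n then W ⟨l, h⟩ b else ∅
    have hV' : ∀ l (h : l.length = n) b, V' (b :: l) = W ⟨l, h⟩ b := by
      intro l h b
      simp only [V', h, dif_pos]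
    refine ⟨⟨V', ?_, ?_⟩, ?_⟩
    · rintro ⟨l, hl⟩
      cases l with
      | nil => simp at hl
      | cons b l =>
        have h : l.length = n := by simpa using hl
        change IsOpen (V' (b :: l))
        rw [hV' l h b]; exact w1 _ _
    · intro hsep
      apply w5
      refine IsSeparable.of_comp (fun l : List.Vector Bool (n + 1) => (l.tail, l.head)) ?_
      convert hsep using 3 with l
      obtain ⟨l, hl⟩ := l
      cases l with
      | nil => simp at hl
      | cons b l =>
        have h : l.length = n := by simpa using hl
        change g '' (W ⟨l, _⟩ b) = _
        rw [← hV' l h b]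
    · intro l hl
      refine ⟨fun b => ?_, fun b => ?_, ?_⟩
      · change closure (V' (b :: l)) ⊆ V l
        rw [hV' l hl b]; exact w2 _ _
      · change Metric.ediam (V' (b :: l)) ≤ _
        rw [hV' l hl b]; exact w3 _ _
      · change ∀ z ∈ V' (true :: l), ∀ z' ∈ V' (false :: l), _
        rw [hV' l hl, hV' l hl]; exact w4 _
  choose next hnext using step
  let V₀ : St 0 := ⟨fun _ => univ, fun _ => isOpen_univ, by
    rintro ⟨B, h1, h2, h3⟩
    refine hbad ((IsSmall.iUnion h3).mono ?_)
    rintro ⟨x, y⟩ hxy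
    obtain ⟨i, hi⟩ := h2 x
    exact mem_iUnion.2 ⟨i, by simpa using hxy, hi⟩⟩
  let V : ∀ n, St n := fun n => Nat.rec V₀ (fun n V => next n V) n
  let A : List Bool → Set Z := fun l => (V l.length).1 l
  have hbadA : ∀ n, ¬ IsSeparable fun l : List.Vector Bool n => g '' A l.1 := by
    intro n
    convert (V n).2.2 using 3 with l
    obtain ⟨l, rfl⟩ := l
    rfl
  have hA1 : CantorScheme.ClosureAntitone A := fun l a => (hnext _ (V l.length) l rfl).1 a
  have hA2 : CantorScheme.VanishingDiam A := by
    intro x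
    rw [← tendsto_add_atTop_iff_nat 1]
    refine tendsto_of_tendsto_of_tendsto_of_le_of_le tendsto_const_nhds
      (ENNReal.tendsto_pow_atTop_nhds_zero_of_lt_one (r := 2⁻¹) (by simp)) (fun _ => zero_le) ?_
    intro n
    have h := (hnext _ (V (PiNat.res x n).length) (PiNat.res x n) rfl).2.1 (x n)
    have hlen : (2⁻¹ : ENNReal) ^ (PiNat.res x n).length = 2⁻¹ ^ n := by rw [PiNat.res_length]
    rw [hlen] at h
    exact h
  have hA3 : ∀ l z, z ∈ A (true :: l) → ∀ z' ∈ A (false :: l), (g z).2 ≠ (g z').2 :=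
    fun l => (hnext _ (V l.length) l rfl).2.2
  -- The cover by `Bᶜ` and `B` makes both restricted pieces empty, hence small; inseparability of
  -- the level forbids this. The case `l = l'`, `B = univ` gives nonemptiness.
  have hsep2 : ∀ n (l l' : List.Vector Bool n) (B : Set X), MeasurableSet B →
      (∀ z ∈ A l.1, (g z).1 ∈ B) → (∀ z ∈ A l'.1, (g z).1 ∉ B) → False := by
    intro n l l' B hB hl hl'
    refine hbadA n (IsSeparable.of_comp (fun b : Bool => if b then l else l') ?_)
    refine ⟨fun b => if b then Bᶜ else B, ?_, ?_, ?_⟩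
    · intro b; cases b
      · exact hB
      · exact hB.compl
    · intro x
      by_cases hx : x ∈ B
      · exact ⟨false, hx⟩
      · exact ⟨true, hx⟩
    · intro b
      refine IsSmall.empty.mono ?_
      cases b
      · rintro _ ⟨⟨z, hz, rfl⟩, h⟩
        exact hl' z hz h
      · rintro _ ⟨⟨z, hz, rfl⟩, h⟩
        exact h (hl z hz)
  have hne : ∀ l, (A l).Nonempty := by
    intro l
    by_contra h
    rw [not_nonempty_iff_eq_empty] at h
    exact hsep2 l.length ⟨l, rfl⟩ ⟨l, rfl⟩ univ MeasurableSet.univ (by simp) (by simp [h])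
  have hdom := hA1.map_of_vanishingDiam hA2 hne
  let ζ : (ℕ → Bool) → Z := fun α => (CantorScheme.inducedMap A).2 ⟨α, hdom ▸ mem_univ α⟩
  have hζ : ∀ α n, ζ α ∈ A (PiNat.res α n) := fun α n => CantorScheme.map_mem _ n
  have hx : ∀ α β, (g (ζ α)).1 = (g (ζ β)).1 := by
    intro α β
    by_contra h
    obtain ⟨U, U', hU, hU', hαU, hβU, hd⟩ := t2_separation h
    have key : ∀ (γ : ℕ → Bool) (U : Set X), IsOpen U → (g (ζ γ)).1 ∈ U →
        ∀ᶠ n in atTop, ∀ z ∈ A (PiNat.res γ n), (g z).1 ∈ U := by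
      intro γ U hU hγ
      have ho : IsOpen ((fun z => (g z).1) ⁻¹' U) := hU.preimage (continuous_fst.comp hg)
      obtain ⟨r, hr, hrU⟩ := EMetric.isOpen_iff.1 ho (ζ γ) hγ
      filter_upwards [(hA2 γ).eventually (gt_mem_nhds hr)] with n hn z hz
      exact hrU (lt_of_le_of_lt (Metric.edist_le_ediam_of_mem hz (hζ γ n)) hn)
    obtain ⟨n, h1, h2⟩ := ((key α U hU hαU).and (key β U' hU' hβU)).exists
    exact hsep2 n ⟨PiNat.res α n, PiNat.res_length α n⟩ ⟨PiNat.res β n, PiNat.res_length β n⟩ U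
      hU.measurableSet h1 (fun z hz hz' => Set.disjoint_left.1 hd hz' (h2 z hz))
  refine ⟨(g (ζ fun _ => true)).1, fun hcount => ?_⟩
  have hinj : Function.Injective fun α => (g (ζ α)).2 := by
    intro α β hαβ
    by_contra hne
    obtain ⟨n, hn⟩ : ∃ n, PiNat.res α n ≠ PiNat.res β n := by
      by_contra! h
      exact hne (PiNat.res_injective (funext h))
    induction n with
    | zero => simp at hn
    | succ n ih =>
      by_cases hr : PiNat.res α n = PiNat.res β n
      · have hα := hζ α (n + 1)
        have hβ := hζ β (n + 1)
        rw [PiNat.res_succ] at hα hβ hn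
        rw [PiNat.res_succ] at hn
        have hab : α n ≠ β n := fun h => hn (by rw [h, hr])
        rw [hr] at hα
        cases h1 : α n <;> cases h2 : β n <;> rw [h1] at hα <;> rw [h2] at hβ
        · exact hab (h1.trans h2.symm)
        · exact hA3 _ _ hβ _ hα hαβ.symm
        · exact hA3 _ _ hα _ hβ hαβ
        · exact hab (h1.trans h2.symm)
      · exact ih hr
  have hsub : range (fun α => (g (ζ α)).2) ⊆ {y | ((g (ζ fun _ => true)).1, y) ∈ range g} := by
    rintro _ ⟨α, rfl⟩
    exact ⟨ζ α, Prod.ext (hx _ _) rfl⟩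
  have hc : Countable (ℕ → Bool) := by
    have := hcount.mono hsub
    rw [← countable_coe_iff] at this
    exact (Function.Injective.countable (f := Set.rangeFactorization fun α => (g (ζ α)).2)
      fun a b h => hinj (congrArg Subtype.val h))
  obtain ⟨f, hf⟩ := exists_surjective_nat (ℕ → Bool)
  obtain ⟨n, hn⟩ := hf fun n => !(f n n)
  have := congrFun hn n
  simp at this

/-- **Lusin–Novikov**: a Borel set with countable sections is covered by countably many Borel
graphs of partial functions. -/
theorem isSmall_of_countable_sections [StandardBorelSpace X] [StandardBorelSpace Y]
    {P : Set (X × Y)} (hP : MeasurableSet P) (hc : ∀ x, {y | (x, y) ∈ P}.Countable) :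
    IsSmall P := by
  let := upgradeStandardBorel X
  let := upgradeStandardBorel Y
  have han : MeasureTheory.AnalyticSet P := hP.analyticSet
  rw [MeasureTheory.analyticSet_iff_exists_polishSpace_range] at han
  obtain ⟨Z, tZ, pZ, g, hg, rfl⟩ := han
  let := TopologicalSpace.upgradeIsCompletelyMetrizable Z
  by_contra hbad
  obtain ⟨x, hx⟩ := exists_uncountable_section hg hbad
  exact hx (hc x)

/-- A Borel equivalence relation with countable classes is a countable union of graphs of Borel
functions. -/
theorem exists_enumeration [StandardBorelSpace X] {R : Setoid X} (hR : IsBorel R)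
    (hc : HasCountableClasses R) :
    ∃ f : ℕ → X → X, (∀ n, Measurable (f n)) ∧ (∀ n x, R x (f n x)) ∧
      ∀ x y, R x y → ∃ n, f n x = y := by
  obtain ⟨𝒢, h1, h2, h3⟩ := isSmall_of_countable_sections hR hc
  have h1' : (insert ∅ 𝒢).Countable := h1.insert ∅
  obtain ⟨G, hG⟩ := h1'.exists_eq_range (insert_nonempty _ _)
  have hG2 : ∀ n, MeasurableSet (G n) ∧ IsGraph (G n) := by
    intro n
    have : G n ∈ insert ∅ 𝒢 := hG ▸ mem_range_self n
    rcases this with h | h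
    · rw [h]; exact ⟨MeasurableSet.empty, fun _ _ _ h => h.elim⟩
    · exact h2 _ h
  have hG3 : ∀ x y, R x y → ∃ n, (x, y) ∈ G n := by
    intro x y hxy
    obtain ⟨g, hg, hxg⟩ := h3 (show (x, y) ∈ {p : X × X | R p.1 p.2} from hxy)
    have : g ∈ range G := hG ▸ mem_insert_of_mem _ hg
    obtain ⟨n, rfl⟩ := this
    exact ⟨n, hxg⟩
  classical
  -- The default value `x` keeps `f n x` in the class of `x` off the domain of the partial function.
  let f : ℕ → X → X := fun n x => if h : ∃ y, (x, y) ∈ G n ∧ R x y then h.choose else x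
  have hf : ∀ n x y, (x, y) ∈ G n → R x y → f n x = y := by
    intro n x y h hr
    have h' : ∃ y, (x, y) ∈ G n ∧ R x y := ⟨y, h, hr⟩
    simp only [f, dif_pos h']
    exact (hG2 n).2 _ _ _ h'.choose_spec.1 h
  refine ⟨f, ?_, ?_, ?_⟩
  · intro n B hB
    have hproj : ∀ B, MeasurableSet B →
        MeasurableSet (Prod.fst '' ((G n ∩ {p : X × X | R p.1 p.2}) ∩ Prod.snd ⁻¹' B)) := by
      intro B hB
      refine MeasurableSet.image_of_measurable_injOn
        (((hG2 n).1.inter hR).inter (measurable_snd hB)) measurable_fst ?_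
      rintro ⟨x, y⟩ h ⟨x', y'⟩ h' (rfl : x = x')
      exact Prod.ext rfl ((hG2 n).2 _ _ _ h.1.1 h'.1.1)
    have : f n ⁻¹' B = (Prod.fst '' ((G n ∩ {p : X × X | R p.1 p.2}) ∩ Prod.snd ⁻¹' B)) ∪
        (B \ Prod.fst '' ((G n ∩ {p : X × X | R p.1 p.2}) ∩ Prod.snd ⁻¹' univ)) := by
      ext x
      by_cases h : ∃ y, (x, y) ∈ G n ∧ R x y
      · obtain ⟨y, hy, hr⟩ := h
        have hfx := hf n x y hy hr
        constructor
        · intro hx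
          exact Or.inl ⟨(x, y), ⟨⟨hy, hr⟩, by simpa [hfx] using hx⟩, rfl⟩
        · rintro (⟨⟨x', y'⟩, ⟨⟨h1, h1'⟩, h2⟩, rfl⟩ | ⟨_, h2⟩)
          · rw [mem_preimage, hf n _ _ h1 h1']; exact h2
          · exact absurd ⟨(x, y), ⟨⟨hy, hr⟩, trivial⟩, rfl⟩ h2
      · have hfx : f n x = x := by simp only [f, dif_neg h]
        constructor
        · intro hx
          refine Or.inr ⟨by simpa [hfx] using hx, ?_⟩
          rintro ⟨⟨x', y'⟩, ⟨⟨h1, h1'⟩, h2⟩, rfl⟩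
          exact h ⟨y', h1, h1'⟩
        · rintro (⟨⟨x', y'⟩, ⟨⟨h1, h1'⟩, h2⟩, rfl⟩ | ⟨h1, _⟩)
          · exact absurd ⟨y', h1, h1'⟩ h
          · simpa [hfx] using h1
    rw [this]
    exact (hproj B hB).union (hB.diff (hproj _ MeasurableSet.univ))
  · intro n x
    by_cases h : ∃ y, (x, y) ∈ G n ∧ R x y
    · simp only [f, dif_pos h]; exact h.choose_spec.2
    · simp only [f, dif_neg h]; exact R.refl x
  · intro x y hxy
    obtain ⟨n, hn⟩ := hG3 x y hxy
    exact ⟨n, hf n x y hn hxy⟩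

end LusinNovikov

/-! ### Contracting parts of a forest -/

section Contraction

/-- Contracting connected parts of a forest yields a forest: `rep x w z` says that the vertex `w`
belongs to the part contracted to `z` in the component of `x`, and `leaf z` is a distinguished
vertex of that part. -/
theorem isAcyclic_of_contraction {W X : Type*} {T : SimpleGraph W} (hT : T.IsAcyclic)
    {G : SimpleGraph X} (rep : X → W → X → Prop) (leaf : X → W)
    (hfun : ∀ x w z z', rep x w z → rep x w z' → z = z')
    (hfib : ∀ x w z, rep x w z →
      Relation.ReflTransGen (fun u v => T.Adj u v ∧ rep x u z ∧ rep x v z) w (leaf z))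
    (hedge : ∀ x z z', G.Reachable x z → G.Adj z z' →
      ∃ w w', T.Adj w w' ∧ rep x w z ∧ rep x w' z') : G.IsAcyclic := by
  rw [SimpleGraph.isAcyclic_iff_forall_adj_isBridge]
  intro a b hab
  rw [SimpleGraph.isBridge_iff]
  intro hreach
  obtain ⟨w₁, w₂, hw, h1, h2⟩ := hedge a a b (SimpleGraph.Reachable.refl _) hab
  have hbr := SimpleGraph.isAcyclic_iff_forall_adj_isBridge.1 hT hw
  rw [SimpleGraph.isBridge_iff] at hbr
  -- Every edge `ab` of `G` is shown to be a bridge. As parts are disjoint, an edge of `T` lying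
  -- over anything but `ab` is not the chosen lift `w₁w₂`. So paths avoiding `ab` lift to paths
  -- avoiding the bridge `w₁w₂`.
  have hstep : ∀ u v z z', T.Adj u v → rep a u z → rep a v z' → s(z, z') ≠ s(a, b) →
      (T.deleteEdges {s(w₁, w₂)}).Reachable u v := by
    intro u v z z' huv hu hv hne
    refine SimpleGraph.Adj.reachable ?_
    rw [SimpleGraph.deleteEdges_adj]
    refine ⟨huv, fun hmem => hne ?_⟩
    rw [mem_singleton_iff, Sym2.eq_iff] at hmem
    rw [Sym2.eq_iff]
    rcases hmem with ⟨rfl, rfl⟩ | ⟨rfl, rfl⟩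
    · exact Or.inl ⟨hfun _ _ _ _ hu h1, hfun _ _ _ _ hv h2⟩
    · exact Or.inr ⟨hfun _ _ _ _ hu h2, hfun _ _ _ _ hv h1⟩
  have hfiber : ∀ w z, rep a w z → (T.deleteEdges {s(w₁, w₂)}).Reachable w (leaf z) := by
    intro w z hwz
    have h := hfib a w z hwz
    generalize leaf z = v at h ⊢
    induction h with
    | refl => exact SimpleGraph.Reachable.refl _
    | tail _ h ih =>
      refine ih.trans (hstep _ _ z z h.1 h.2.1 h.2.2 fun he => hab.ne ?_)
      rw [Sym2.eq_iff] at he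
      rcases he with ⟨h, h'⟩ | ⟨h, h'⟩
      · exact h.symm.trans h'
      · exact h'.symm.trans h
  have hwalk : ∀ z, (G.deleteEdges {s(a, b)}).Reachable a z →
      (T.deleteEdges {s(w₁, w₂)}).Reachable (leaf a) (leaf z) := by
    intro z hz
    rw [SimpleGraph.reachable_iff_reflTransGen] at hz
    induction hz with
    | refl => exact SimpleGraph.Reachable.refl _
    | @tail y z hy hyz ih =>
      rw [SimpleGraph.deleteEdges_adj] at hyz
      have hay : G.Reachable a y :=
        SimpleGraph.Reachable.mono (SimpleGraph.deleteEdges_le _)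
          ((SimpleGraph.reachable_iff_reflTransGen _ _).2 hy)
      obtain ⟨u, v, huv, hu, hv⟩ := hedge a y z hay hyz.1
      exact ih.trans ((hfiber u y hu).symm.trans
        ((hstep u v y z huv hu hv fun h => hyz.2 h).trans (hfiber v z hv)))
  exact hbr ((hfiber _ _ h1).trans ((hwalk b hreach).trans (hfiber _ _ h2).symm))

end Contraction

/-! ### The Bass–Serre forest -/

section BassSerre

variable {X : Type*}

/-- The equivalence relations whose classes are the vertices of the Bass–Serre graph: equality,
`Q true` and `Q false`. -/
def vertexRel (Q : Bool → Setoid X) : Option Bool → Setoid X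
  | none => ⊥
  | some i => Q i

/-- The Bass–Serre graph of a pair of equivalence relations, with a leaf attached for every point:
each point `y` joins its `Q true`-class to its `Q false`-class and to the leaf `y`. -/
def bassSerre (Q : Bool → Setoid X) : SimpleGraph (Σ i, Quotient (vertexRel Q i)) where
  Adj w w' := (w.1 ≠ w'.1 ∧ (w.1 = some true ∨ w'.1 = some true)) ∧
    ∃ y, w.2 = Quotient.mk _ y ∧ w'.2 = Quotient.mk _ y
  symm := ⟨by
    rintro w w' ⟨⟨h1, h2⟩, y, h3, h4⟩
    exact ⟨⟨h1.symm, h2.symm⟩, y, h4, h3⟩⟩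
  loopless := ⟨fun w h => h.1.1 rfl⟩

/-- The vertex of type `i` of the Bass–Serre graph determined by the point `y`. -/
def vertex (Q : Bool → Setoid X) (i : Option Bool) (y : X) : Σ i, Quotient (vertexRel Q i) :=
  ⟨i, Quotient.mk _ y⟩

theorem vertex_eq_vertex_iff {Q : Bool → Setoid X} {i j : Option Bool} {y z : X} :
    vertex Q i y = vertex Q j z ↔ i = j ∧ vertexRel Q i y z := by
  constructor
  · intro h
    have hij : i = j := congrArg Sigma.fst h
    subst hij
    refine ⟨rfl, Quotient.exact (s := vertexRel Q i) ?_⟩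
    simpa [vertex] using h
  · rintro ⟨rfl, h⟩
    exact congrArg (Sigma.mk i) (Quotient.sound h)

theorem bassSerre_adj {Q : Bool → Setoid X} {i j : Option Bool} (y : X) (hij : i ≠ j)
    (h : i = some true ∨ j = some true) : (bassSerre Q).Adj (vertex Q i y) (vertex Q j y) :=
  ⟨⟨hij, h⟩, y, rfl, rfl⟩

theorem exists_of_bassSerre_adj {Q : Bool → Setoid X} {w w' : Σ i, Quotient (vertexRel Q i)}
    (h : (bassSerre Q).Adj w w') : ∃ y, w = vertex Q w.1 y ∧ w' = vertex Q w'.1 y := by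
  obtain ⟨-, y, h1, h2⟩ := h
  exact ⟨y, Sigma.ext rfl (heq_of_eq h1), Sigma.ext rfl (heq_of_eq h2)⟩

/-- The points labelling successive edges of a cycle form a closed reduced tuple. Consecutive labels
share a vertex and so are related by its relation. They are not related by the other one, since a
cycle does not backtrack. -/
theorem bassSerre_isAcyclic {Q : Bool → Setoid X} {R₃ : Setoid X} (h₃ : ∀ i, R₃ ≤ Q i)
    (hred : ∀ (n : ℕ) (x : ℕ → X), IsReduced (Q true) (Q false) R₃ n x → x n ≠ x 1) :
    (bassSerre Q).IsAcyclic := by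
  intro v c hc
  have hL := hc.three_le_length
  set L := c.length with hLdef
  have hL0 : 0 < L := by omega
  let w : ℕ → Σ i, Quotient (vertexRel Q i) := fun k => c.getVert (k % L)
  have hwL : c.getVert L = c.getVert 0 := by simp [hLdef]
  have hmod : ∀ k, w (k + 1) = c.getVert (k % L + 1) := by
    intro k
    have hk := Nat.mod_lt k hL0
    rcases Nat.lt_or_ge (k % L + 1) L with h | h
    · simp only [w]
      rw [Nat.add_mod, Nat.mod_eq_of_lt (show 1 < L by omega), Nat.mod_eq_of_lt h]
    · have h' : k % L + 1 = L := by omega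
      simp only [w]
      rw [Nat.add_mod, Nat.mod_eq_of_lt (show 1 < L by omega), h', Nat.mod_self, hwL]
  have hadj : ∀ k, (bassSerre Q).Adj (w k) (w (k + 1)) := by
    intro k
    rw [hmod]
    exact c.adj_getVert_succ (Nat.mod_lt k hL0)
  have hne : ∀ k, w k ≠ w (k + 2) := by
    intro k h
    have h1 := Nat.mod_lt k hL0
    have h2 := Nat.mod_lt (k + 2) hL0
    have := hc.getVert_injOn' (show k % L ≤ L - 1 by omega) (show (k + 2) % L ≤ L - 1 by omega) h
    have hd : L ∣ (k + 2) - k := (Nat.modEq_iff_dvd' (by omega)).1 this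
    have := Nat.le_of_dvd (by omega) hd
    omega
  have hex : ∀ k, ∃ y, w k = vertex Q (w k).1 y ∧ w (k + 1) = vertex Q (w (k + 1)).1 y :=
    fun k => exists_of_bassSerre_adj (hadj k)
  choose x₀ hx₀ hx₀' using hex
  let x : ℕ → X := fun k => x₀ (k % L)
  have hwm : ∀ k, w (k % L) = w k := fun k => by simp [w]
  have hwm' : ∀ k, w (k % L + 1) = w (k + 1) := fun k => by
    rw [hmod, hmod, Nat.mod_mod]
  have hx : ∀ k, w k = vertex Q (w k).1 (x k) := by
    intro k
    have := hx₀ (k % L)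
    rwa [hwm] at this
  have hx' : ∀ k, w (k + 1) = vertex Q (w (k + 1)).1 (x k) := by
    intro k
    have := hx₀' (k % L)
    rwa [hwm'] at this
  have hrel : ∀ k, vertexRel Q (w (k + 1)).1 (x k) (x (k + 1)) := fun k =>
    (vertex_eq_vertex_iff.1 ((hx' k).symm.trans (hx (k + 1)))).2
  have hnrel : ∀ k, (w k).1 = (w (k + 2)).1 → ¬ vertexRel Q (w k).1 (x k) (x (k + 1)) := by
    intro k hk h
    apply hne k
    rw [hx k, hx' (k + 1)]
    exact vertex_eq_vertex_iff.2 ⟨hk, h⟩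
  have hlink := fun k => (hadj k).1
  -- A leaf has a single neighbour, so a cycle through it would backtrack.
  have hsome : ∀ k, (w (k + 1)).1 ≠ none := by
    intro k h
    have h1 : (w k).1 = some true := (hlink k).2.resolve_right (by simp [h])
    have h2 : (w (k + 2)).1 = some true := (hlink (k + 1)).2.resolve_left (by simp [h])
    have h3 := hrel k
    rw [h] at h3
    have h4 : x k = x (k + 1) := h3
    refine hnrel k (h1.trans h2.symm) ?_
    rw [h4]
  have hsome' : ∀ k, ∃ b, (w (k + 1)).1 = some b := fun k => Option.ne_none_iff_exists'.1 (hsome k)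
  choose β hβ using hsome'
  have halt : ∀ k, β (k + 1) = !β k := by
    intro k
    have := (hlink (k + 1)).1
    rw [hβ, hβ] at this
    generalize β k = u, β (k + 1) = v at this
    revert u v
    decide
  have hQ : ∀ k, Q (β k) (x k) (x (k + 1)) := by
    intro k
    have := hrel k
    rwa [hβ] at this
  have hQ' : ∀ k, ¬ Q (β k) (x (k + 1)) (x (k + 2)) := by
    intro k h
    refine hnrel (k + 1) ?_ ?_
    · rw [hβ, hβ (k + 2), halt, halt, Bool.not_not]
    · rw [hβ]; exact h
  -- The labels have period `L`, so the tuple of length `L + 1` closes up.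
  refine hred (L + 1) x ⟨by omega, ?_, ?_, ?_, ?_, ?_⟩ ?_
  · intro i _ _
    have := hQ i
    cases h : β i <;> rw [h] at this
    · exact Or.inr this
    · exact Or.inl this
  · rintro i hi _ ⟨h1, h2⟩
    obtain ⟨k, rfl⟩ := Nat.exists_eq_add_of_le' hi
    have a1 := hQ' k
    have a2 := hQ' (k + 1)
    rw [halt] at a2
    cases h : β k <;> rw [h] at a1 a2
    · exact a2 h2
    · exact a1 h1
  · rintro i hi _ ⟨h1, h2⟩
    obtain ⟨k, rfl⟩ := Nat.exists_eq_add_of_le' hi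
    have a1 := hQ' k
    have a2 := hQ' (k + 1)
    rw [halt] at a2
    cases h : β k <;> rw [h] at a1 a2
    · exact a1 h1
    · exact a2 h2
  · intro _ i hi _ h
    obtain ⟨k, rfl⟩ := Nat.exists_eq_add_of_le' hi
    exact hQ' k (h₃ _ h)
  · omega
  · simp only [x]
    rw [Nat.add_mod_left]

end BassSerre

/-! ### Borel selection inside countable classes -/

section Selection

variable {X : Type*} [MeasurableSpace X]

theorem IsBorel.measurable_rel {R : Setoid X} (hR : IsBorel R) {Z : Type*} [MeasurableSpace Z]
    {a b : Z → X} (ha : Measurable a) (hb : Measurable b) :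
    Measurable fun z => R (a z) (b z) :=
  measurableSet_setOfPred.1 ((ha.prodMk hb) hR)

/-- `f` is a sequence of Borel functions whose graphs cover `R`. -/
structure IsEnumeration (R : Setoid X) (f : ℕ → X → X) : Prop where
  measurable : ∀ n, Measurable (f n)
  rel : ∀ n x, R x (f n x)
  surj : ∀ x y, R x y → ∃ n, f n x = y

variable {R : Setoid X} {f : ℕ → X → X}

theorem IsEnumeration.measurable_exists (hf : IsEnumeration R f) {Z : Type*} [MeasurableSpace Z]
    {h : Z → X} (hh : Measurable h) {A : Z → X → Prop} (hA : Measurable fun p : Z × X => A p.1 p.2)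
    (hAR : ∀ z q, A z q → R (h z) q) : Measurable fun z => ∃ q, A z q := by
  have : (fun z => ∃ q, A z q) = fun z => ∃ n, A z (f n (h z)) := by
    ext z
    constructor
    · rintro ⟨q, hq⟩
      obtain ⟨n, rfl⟩ := hf.surj _ _ (hAR z q hq)
      exact ⟨n, hq⟩
    · rintro ⟨n, hn⟩
      exact ⟨_, hn⟩
  rw [this]
  exact Measurable.exists fun n => hA.comp (measurable_id.prodMk ((hf.measurable n).comp hh))

/-- Borel uniformization within the classes of `R`; the value depends only on the base point and
on the section. -/
theorem IsEnumeration.exists_uniformization (hf : IsEnumeration R f) {Z : Type*}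
    [MeasurableSpace Z] {h : Z → X} (hh : Measurable h) {A : Z → X → Prop}
    (hA : Measurable fun p : Z × X => A p.1 p.2) (hAR : ∀ z q, A z q → R (h z) q) :
    ∃ F : Z → X, Measurable F ∧ (∀ z, (∃ q, A z q) → A z (F z)) ∧
      ∀ z z', h z = h z' → (∀ q, A z q ↔ A z' q) → F z = F z' := by
  classical
  -- The second alternative makes the search for the first index total; it plays no role where the
  -- section is nonempty.
  let p : ℕ → Z → Prop := fun n z => A z (f n (h z)) ∨ ¬ ∃ q, A z q
  have hp : ∀ z, ∃ n, p n z := by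
    intro z
    by_cases hz : ∃ q, A z q
    · obtain ⟨q, hq⟩ := hz
      obtain ⟨n, rfl⟩ := hf.surj _ _ (hAR z q hq)
      exact ⟨n, Or.inl hq⟩
    · exact ⟨0, Or.inr hz⟩
  have hpm : ∀ n, MeasurableSet {z | p n z} := fun n => measurableSet_setOfPred.2
    ((hA.comp (measurable_id.prodMk ((hf.measurable n).comp hh))).or
      (hf.measurable_exists hh hA hAR).not)
  refine ⟨fun z => f (Nat.find (hp z)) (h z),
    Measurable.find (fun n => (hf.measurable n).comp hh) hpm hp, ?_, ?_⟩
  · intro z hz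
    exact (Nat.find_spec (hp z)).resolve_right (not_not.2 hz)
  · intro z z' hzz' hiff
    have : ∀ n, p n z ↔ p n z' := by
      intro n
      simp only [p, hzz', hiff]
    have hfind : Nat.find (hp z) = Nat.find (hp z') := by
      simp only [this]
    simp only [hfind, hzz']

/-- Where `f m` undoes `f n`, the map `f n` is injective and so an element of the pseudogroup, to
which smoothness applies. -/
theorem IsEnumeration.exists_transversal [StandardBorelSpace X] (hf : IsEnumeration R f)
    {Q S : Setoid X}
    (hsm : ∀ φ : PartialEquiv X X, MemFullPseudogroup R φ →
      IsSmooth (conj φ Q ⊓ restrict S φ.source)) (n m : ℕ) :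
    ∃ D : Set X, MeasurableSet D ∧
      (∀ x, f m (f n x) = x → ∃ d ∈ D, S x d ∧ Q (f n x) (f n d)) ∧
      ∀ d ∈ D, ∀ d' ∈ D, S d d' → Q (f n d) (f n d') → d = d' := by
  let φ : PartialEquiv X X :=
    { toFun := f n
      invFun := f m
      source := {x | f m (f n x) = x}
      target := {y | f n (f m y) = y}
      map_source' := fun x hx => congrArg (f n) hx
      map_target' := fun y hy => congrArg (f m) hy
      left_inv' := fun x hx => hx
      right_inv' := fun y hy => hy }
  have hmeas : ∀ n m, MeasurableSet {x | f m (f n x) = x} := fun n m =>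
    measurableSet_eq_fun ((hf.measurable m).comp (hf.measurable n)) measurable_id
  have hφ : MemFullPseudogroup R φ :=
    { measurableSet_source := hmeas n m
      measurableSet_target := hmeas m n
      measurable_toFun := (hf.measurable n).comp measurable_subtype_coe
      measurable_invFun := (hf.measurable m).comp measurable_subtype_coe
      graph_subset := fun x _ => hf.rel n x }
  obtain ⟨D, hD, hD'⟩ := hsm φ hφ
  refine ⟨Subtype.val '' D, (hmeas n m).subtype_image hD, ?_, ?_⟩
  · intro x hx
    obtain ⟨d, ⟨hdD, hd⟩, -⟩ := hD' ⟨x, hx⟩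
    exact ⟨d, ⟨d, hdD, rfl⟩, hd.2, hd.1⟩
  · rintro _ ⟨d, hd, rfl⟩ _ ⟨d', hd', rfl⟩ hS hQ
    obtain ⟨e, -, he⟩ := hD' d
    exact congrArg Subtype.val ((he d ⟨hd, (conj φ Q ⊓ restrict S φ.source).refl d⟩).trans
      (he d' ⟨hd', hQ, hS⟩).symm)

/-- Smoothness of all the relations `φ⁻¹ Q φ ∩ S` gives a Borel choice of a point in the `S`-class
of `x` that depends only on this class and on the `Q`-class of `y`. -/
theorem IsEnumeration.exists_selector [StandardBorelSpace X] (hf : IsEnumeration R f)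
    {Q S : Setoid X} (hQ : IsBorel Q) (hS : IsBorel S) (hSR : S ≤ R)
    (hsm : ∀ φ : PartialEquiv X X, MemFullPseudogroup R φ →
      IsSmooth (conj φ Q ⊓ restrict S φ.source)) :
    ∃ σ : X × X → X, Measurable σ ∧ (∀ x y, R x y → S x (σ (x, y))) ∧
      ∀ x x' y y', R x y → R x' y' → S x x' → Q y y' → σ (x, y) = σ (x', y') := by
  choose D₀ h1 h2 h3 using hf.exists_transversal hsm
  let D : ℕ → Set X := fun k => D₀ k.unpair.1 k.unpair.2
  let g : ℕ → X → X := fun k => f k.unpair.1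
  -- These conditions see only the `S`-class of `z.1` and the `Q`-class of `z.2`. The least `k` that
  -- can be met is therefore invariant, and the transversal leaves just one `s` for it.
  let Γ : ℕ → X × X → X → Prop := fun k z s => s ∈ D k ∧ S z.1 s ∧ Q (g k s) z.2
  let Δ : X × X → X → Prop := fun z s => ∃ k, Γ k z s ∧ ∀ k' < k, ¬ ∃ s', Γ k' z s'
  have hΓm : ∀ k, Measurable fun p : (X × X) × X => Γ k p.1 p.2 := fun k =>
    (measurableSet_setOfPred.1 (measurable_snd (h1 _ _)) : Measurable fun p : (X × X) × X => p.2 ∈ D k).and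
      ((hS.measurable_rel (measurable_fst.comp measurable_fst) measurable_snd).and
        (hQ.measurable_rel ((hf.measurable _).comp measurable_snd)
          (measurable_snd.comp measurable_fst)))
  have hΔm : Measurable fun p : (X × X) × X => Δ p.1 p.2 := by
    refine Measurable.exists fun k => (hΓm k).and (Measurable.forall fun k' => ?_)
    refine Measurable.imp measurable_const ?_
    exact ((hf.measurable_exists measurable_fst (hΓm k') fun z q h => hSR h.2.1).not).comp
      measurable_fst
  have hΔR : ∀ z q, Δ z q → R z.1 q := by
    rintro z q ⟨k, h, -⟩
    exact hSR h.2.1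
  obtain ⟨σ, hσm, hσ, -⟩ := hf.exists_uniformization measurable_fst hΔm hΔR
  have hex : ∀ x y, R x y → ∃ s, Δ (x, y) s := by
    intro x y hxy
    classical
    have hk : ∃ k s, Γ k (x, y) s := by
      obtain ⟨n, rfl⟩ := hf.surj _ _ hxy
      obtain ⟨m, hm⟩ := hf.surj _ _ (R.symm hxy)
      obtain ⟨d, hd, hSd, hQd⟩ := h2 n m x hm
      refine ⟨Nat.pair n m, d, ?_⟩
      simp only [Γ, D, g, Nat.unpair_pair]
      exact ⟨hd, hSd, Q.symm hQd⟩
    obtain ⟨s, hs⟩ := Nat.find_spec hk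
    exact ⟨s, Nat.find hk, hs, fun k' hk' => Nat.find_min hk hk'⟩
  have huniq : ∀ z s s', Δ z s → Δ z s' → s = s' := by
    rintro z s s' ⟨k, hk, hmin⟩ ⟨k', hk', hmin'⟩
    have hkk : k = k' := by
      rcases lt_trichotomy k k' with h | h | h
      · exact absurd ⟨s, hk⟩ (hmin' k h)
      · exact h
      · exact absurd ⟨s', hk'⟩ (hmin k' h)
    subst hkk
    exact h3 _ _ s hk.1 s' hk'.1 (S.trans (S.symm hk.2.1) hk'.2.1)
      (Q.trans hk.2.2 (Q.symm hk'.2.2))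
  refine ⟨σ, hσm, ?_, ?_⟩
  · intro x y hxy
    obtain ⟨k, h, -⟩ := hσ _ (hex x y hxy)
    exact h.2.1
  · intro x x' y y' hxy hxy' hxx hyy
    refine huniq (x', y') _ _ ?_ (hσ _ (hex _ _ hxy'))
    have hΓ : ∀ k s, Γ k (x, y) s ↔ Γ k (x', y') s := by
      intro k s
      refine and_congr_right fun _ => and_congr ?_ ?_
      · exact ⟨fun h => S.trans (S.symm hxx) h, fun h => S.trans hxx h⟩
      · exact ⟨fun h => Q.trans h hyy, fun h => Q.trans h (Q.symm hyy)⟩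
    have := hσ _ (hex x y hxy)
    simpa only [Δ, hΓ] using this

end Selection

/-! ### Projecting the Bass–Serre tree onto an `S`-class -/

section Projection

variable {X : Type*}

/-- In the Bass–Serre graph, the `Q i`-class of `y` is at distance at most `n` from a
`Q true`-class that meets the `S`-class of `x`. -/
def Near (S : Setoid X) (Q : Bool → Setoid X) : ℕ → Bool → X → X → Prop
  | 0, i, x, y => i = true ∧ ∃ z, S x z ∧ Q i y z
  | n + 1, i, x, y => Near S Q n i x y ∨ ∃ z, Q i y z ∧ Near S Q n (!i) x z

variable {S R : Setoid X} {Q : Bool → Setoid X}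

theorem Near.congr {n : ℕ} {i : Bool} {x x' y y' : X} (hx : S x x') (hy : Q i y y')
    (h : Near S Q n i x y) : Near S Q n i x' y' := by
  induction n generalizing i y y' with
  | zero =>
    obtain ⟨rfl, z, h1, h2⟩ := h
    exact ⟨rfl, z, S.trans (S.symm hx) h1, (Q _).trans ((Q _).symm hy) h2⟩
  | succ n ih =>
    rcases h with h | ⟨z, h1, h2⟩
    · exact Or.inl (ih hy h)
    · exact Or.inr ⟨z, (Q _).trans ((Q _).symm hy) h1, ih ((Q _).refl z) h2⟩

theorem Near.mono {n m : ℕ} (hnm : n ≤ m) {i : Bool} {x y : X} (h : Near S Q n i x y) :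
    Near S Q m i x y := by
  induction hnm with
  | refl => exact h
  | step _ ih => exact Or.inl ih

theorem exists_near (hR : R = Q true ⊔ Q false) {x y : X} (hxy : R x y) (i : Bool) :
    ∃ n, Near S Q n i x y := by
  let P : X → Prop := fun y => ∀ i, ∃ n, Near S Q n i x y
  -- Reachability is preserved by both generating relations, so it is constant on classes of their
  -- supremum.
  let E : Setoid X := Setoid.comap P ⟨fun p q => (p ↔ q), ⟨fun _ => Iff.rfl, Iff.symm, Iff.trans⟩⟩
  have hstep : ∀ j y y', Q j y y' → P y → P y' := by
    intro j y y' hj hy i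
    obtain ⟨n, hn⟩ := hy j
    have hn' := hn.congr (S.refl x) hj
    by_cases hij : i = j
    · subst hij
      exact ⟨n, hn'⟩
    · refine ⟨n + 1, Or.inr ⟨y', (Q _).refl y', ?_⟩⟩
      have : (!i) = j := by cases i <;> cases j <;> simp_all
      rw [this]
      exact hn'
  have hE : ∀ j, Q j ≤ E := fun j y y' h => ⟨hstep j y y' h, hstep j y' y ((Q j).symm h)⟩
  have hRE : R ≤ E := hR ▸ sup_le (hE true) (hE false)
  have hP : P x ↔ P y := hRE hxy
  refine hP.1 ?_ i
  have h0 : Near S Q 0 true x x := ⟨rfl, x, S.refl x, (Q _).refl x⟩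
  rintro (_ | _)
  · exact ⟨1, Or.inr ⟨x, (Q _).refl x, h0⟩⟩
  · exact ⟨0, h0⟩

open Classical in
/-- Iterate the step functions `q`, at most `n` times, until a point of the `S`-class of `x` is
reached. -/
noncomputable def flow (S : Setoid X) (q : Bool → X × X → X) : ℕ → Bool → X → X → X
  | 0, i, x, y => q i (x, y)
  | n + 1, i, x, y => if i = true ∧ S x (q i (x, y)) then q i (x, y)
      else flow S q n (!i) x (q i (x, y))

/-- `q` is a family of step functions: `q i (x, y)` is a point of the `Q i`-class of `y` which lies
in the `S`-class of `x`, or through which one gets to a `Q (!i)`-class nearer to it. -/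
structure IsStep (R S : Setoid X) (Q : Bool → Setoid X) (q : Bool → X × X → X) : Prop where
  rel : ∀ i x y, R x y → Q i y (q i (x, y))
  zero : ∀ i x y, R x y → Near S Q 0 i x y → i = true ∧ S x (q i (x, y))
  succ : ∀ n i x y, R x y → Near S Q (n + 1) i x y →
    (i = true ∧ S x (q i (x, y))) ∨ Near S Q n (!i) x (q i (x, y))
  congr : ∀ i x x' y y', R x y → R x' y' → S x x' → Q i y y' → q i (x, y) = q i (x', y')

/-- Each step that does not exit lowers the distance bound, so the exit occurs within `n` steps and
extra iterations change nothing. -/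
theorem IsStep.flow_eq {q : Bool → X × X → X} (hq : IsStep R S Q q) (hQR : ∀ i, Q i ≤ R)
    {n m : ℕ} (hnm : n ≤ m) {i : Bool} {x y : X} (hxy : R x y) (h : Near S Q n i x y) :
    flow S q m i x y = flow S q n i x y := by
  induction n generalizing m i y with
  | zero =>
    cases m with
    | zero => rfl
    | succ m =>
      simp only [flow]
      rw [if_pos (hq.zero i x y hxy h)]
  | succ n ih =>
    obtain ⟨m, rfl⟩ : ∃ k, m = k + 1 := ⟨m - 1, by omega⟩
    simp only [flow]
    split_ifs with hex
    · rfl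
    · exact ih (by omega) (R.trans hxy (hQR i (hq.rel i x y hxy)))
        ((hq.succ n i x y hxy h).resolve_left hex)

theorem IsStep.flow_congr {q : Bool → X × X → X} (hq : IsStep R S Q q) (hQR : ∀ i, Q i ≤ R)
    (hSR : S ≤ R) (n : ℕ) {i : Bool} {x x' y y' : X} (hxy : R x y) (hx : S x x') (hy : Q i y y') :
    flow S q n i x y = flow S q n i x' y' := by
  have hR : ∀ i y y', R x y → Q i y y' → R x' y' := fun i y y' hxy hy =>
    R.trans (R.symm (hSR hx)) (R.trans hxy (hQR i hy))
  induction n generalizing i y y' with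
  | zero => exact hq.congr i x x' y y' hxy (hR i y y' hxy hy) hx hy
  | succ n ih =>
    have h := hq.congr i x x' y y' hxy (hR i y y' hxy hy) hx hy
    simp only [flow]
    rw [← h]
    have hS : S x (q i (x, y)) ↔ S x' (q i (x, y)) :=
      ⟨fun h => S.trans (S.symm hx) h, fun h => S.trans hx h⟩
    rw [hS]
    split_ifs
    · rfl
    · exact ih (R.trans hxy (hQR i (hq.rel i x y hxy))) ((Q _).refl _)

open Classical in
/-- The point of the `S`-class of `x` where the step functions `q` lead from the `Q i`-class
of `y`. -/
noncomputable def project (S : Setoid X) (Q : Bool → Setoid X) (q : Bool → X × X → X) (i : Bool)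
    (z : X × X) : X :=
  if h : ∃ n, Near S Q n i z.1 z.2 then flow S q (Nat.find h) i z.1 z.2 else z.1

theorem IsStep.project_eq {q : Bool → X × X → X} (hq : IsStep R S Q q) (hQR : ∀ i, Q i ≤ R)
    {n : ℕ} {i : Bool} {x y : X} (hxy : R x y) (h : Near S Q n i x y) :
    project S Q q i (x, y) = flow S q n i x y := by
  classical
  have h' : ∃ n, Near S Q n i x y := ⟨n, h⟩
  have hp : project S Q q i (x, y) = flow S q (Nat.find h') i x y := by
    simp only [project]
    rw [dif_pos h']
  rw [hp]
  exact (hq.flow_eq hQR (Nat.find_min' h' h) hxy (Nat.find_spec h')).symm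

theorem IsStep.project_of_exit {q : Bool → X × X → X} (hq : IsStep R S Q q)
    (hQR : ∀ i, Q i ≤ R) (hR : R = Q true ⊔ Q false) {i : Bool} {x y : X} (hxy : R x y)
    (h : i = true ∧ S x (q i (x, y))) : project S Q q i (x, y) = q i (x, y) := by
  obtain ⟨n, hn⟩ := exists_near (S := S) hR hxy i
  rw [hq.project_eq hQR hxy (hn.mono n.le_succ)]
  simp only [flow]
  rw [if_pos h]

theorem IsStep.project_of_not_exit {q : Bool → X × X → X} (hq : IsStep R S Q q)
    (hQR : ∀ i, Q i ≤ R) (hR : R = Q true ⊔ Q false) {i : Bool} {x y : X} (hxy : R x y)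
    (h : ¬ (i = true ∧ S x (q i (x, y)))) :
    project S Q q i (x, y) = project S Q q (!i) (x, q i (x, y)) := by
  obtain ⟨n, hn⟩ := exists_near (S := S) hR hxy i
  have hn' := (hq.succ n i x y hxy (hn.mono n.le_succ)).resolve_left h
  rw [hq.project_eq hQR hxy (hn.mono n.le_succ),
    hq.project_eq hQR (R.trans hxy (hQR i (hq.rel i x y hxy))) hn']
  simp only [flow]
  rw [if_neg h]

theorem IsStep.project_congr {q : Bool → X × X → X} (hq : IsStep R S Q q) (hQR : ∀ i, Q i ≤ R)
    (hR : R = Q true ⊔ Q false) (hSR : S ≤ R) {i : Bool} {x x' y y' : X} (hxy : R x y)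
    (hx : S x x') (hy : Q i y y') :
    project S Q q i (x, y) = project S Q q i (x', y') := by
  obtain ⟨n, hn⟩ := exists_near (S := S) hR hxy i
  rw [hq.project_eq hQR hxy hn, hq.project_eq hQR
    (R.trans (R.symm (hSR hx)) (R.trans hxy (hQR i hy))) (hn.congr hx hy)]
  exact hq.flow_congr hQR hSR n hxy hx hy

/-- The Bass–Serre vertex `w` is projected to the point `z` of the `S`-class of `x`. -/
def ProjectsTo (R S : Setoid X) (Q : Bool → Setoid X) (q : Bool → X × X → X) (x : X)
    (w : Σ i, Quotient (vertexRel Q i)) (z : X) : Prop :=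
  (w = vertex Q none z ∧ S x z) ∨
    ∃ i y, R x y ∧ w = vertex Q (some i) y ∧ project S Q q i (x, y) = z

theorem IsStep.projectsTo_unique {q : Bool → X × X → X} (hq : IsStep R S Q q)
    (hQR : ∀ i, Q i ≤ R) (hR : R = Q true ⊔ Q false) (hSR : S ≤ R) {x z z' : X}
    {w : Σ i, Quotient (vertexRel Q i)} (h : ProjectsTo R S Q q x w z)
    (h' : ProjectsTo R S Q q x w z') : z = z' := by
  rcases h with ⟨rfl, h⟩ | ⟨i, y, hy, rfl, rfl⟩ <;>
    rcases h' with ⟨he, h'⟩ | ⟨i', y', hy', he, rfl⟩ <;>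
    obtain ⟨h1, h2⟩ := vertex_eq_vertex_iff.1 he
  · exact h2
  · simp at h1
  · simp at h1
  · obtain rfl : i = i' := by simpa using h1
    exact hq.project_congr hQR hR hSR hy (S.refl x) h2

/-- The trajectory of the step functions is itself a path of the tree. The projection is constant
along it, so the part of a vertex is connected to its leaf. -/
theorem IsStep.reflTransGen_of_near {q : Bool → X × X → X} (hq : IsStep R S Q q)
    (hQR : ∀ i, Q i ≤ R) (hR : R = Q true ⊔ Q false) {x : X} (n : ℕ) (i : Bool) (y : X)
    (hxy : R x y) (hn : Near S Q n i x y) :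
    S x (project S Q q i (x, y)) ∧
    Relation.ReflTransGen (fun u v => (bassSerre Q).Adj u v ∧
        ProjectsTo R S Q q x u (project S Q q i (x, y)) ∧
        ProjectsTo R S Q q x v (project S Q q i (x, y)))
      (vertex Q (some i) y) (vertex Q none (project S Q q i (x, y))) := by
  have hrel := hq.rel i x y hxy
  have hv : vertex Q (some i) y = vertex Q (some i) (q i (x, y)) :=
    vertex_eq_vertex_iff.2 ⟨rfl, hrel⟩
  have hself : ProjectsTo R S Q q x (vertex Q (some i) y) (project S Q q i (x, y)) :=
    Or.inr ⟨i, y, hxy, rfl, rfl⟩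
  by_cases hex : i = true ∧ S x (q i (x, y))
  · have hp := hq.project_of_exit hQR hR hxy hex
    obtain ⟨rfl, hS⟩ := hex
    have hS' : S x (project S Q q true (x, y)) := hp.symm ▸ hS
    refine ⟨hS', Relation.ReflTransGen.single ⟨?_, hself, Or.inl ⟨rfl, hS'⟩⟩⟩
    rw [hv, hp]
    exact bassSerre_adj _ (by simp) (Or.inl rfl)
  · have hp := hq.project_of_not_exit hQR hR hxy hex
    have hxq : R x (q i (x, y)) := R.trans hxy (hQR i hrel)
    cases n with
    | zero => exact absurd (hq.zero i x y hxy hn) hex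
    | succ n =>
      obtain ⟨h1, h2⟩ := hq.reflTransGen_of_near hQR hR n (!i) (q i (x, y)) hxq
        ((hq.succ n i x y hxy hn).resolve_left hex)
      rw [← hp] at h1 h2
      refine ⟨h1, Relation.ReflTransGen.head ⟨?_, hself, Or.inr ⟨!i, _, hxq, rfl, hp.symm⟩⟩ h2⟩
      rw [hv]
      exact bassSerre_adj _ (by simp) (by cases i <;> simp)

theorem IsStep.rel_project {q : Bool → X × X → X} (hq : IsStep R S Q q) (hQR : ∀ i, Q i ≤ R)
    (hR : R = Q true ⊔ Q false) {i : Bool} {x y : X} (hxy : R x y) :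
    S x (project S Q q i (x, y)) := by
  obtain ⟨n, hn⟩ := exists_near (S := S) hR hxy i
  exact (hq.reflTransGen_of_near hQR hR n i y hxy hn).1

/-- The graph on `X` obtained by contracting the Bass–Serre trees along the projections to the
classes of `S`. -/
def treeing (R S : Setoid X) (p : Bool → X × X → X)
    (hp : ∀ i x x' y, R x y → S x x' → p i (x, y) = p i (x', y)) (hSR : S ≤ R) :
    SimpleGraph X where
  Adj a b := a ≠ b ∧ S a b ∧ ((p true (a, a) = b ∨ p true (b, b) = a) ∨
    ∃ y, R a y ∧ ((p true (a, y) = a ∧ p false (a, y) = b) ∨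
      (p true (a, y) = b ∧ p false (a, y) = a)))
  symm := ⟨by
    rintro a b ⟨hne, hS, h⟩
    refine ⟨hne.symm, S.symm hS, h.imp Or.symm ?_⟩
    rintro ⟨y, hy, h⟩
    refine ⟨y, R.trans (R.symm (hSR hS)) hy, ?_⟩
    rw [← hp true a b y hy hS, ← hp false a b y hy hS]
    exact h.symm⟩
  loopless := ⟨fun a h => h.1 rfl⟩

/-- Each edge lifts by its definition: the first two clauses to a leaf edge, the last to an edge
between a `Q true`-class and a `Q false`-class. -/
theorem IsStep.treeing_isAcyclic {q : Bool → X × X → X} (hq : IsStep R S Q q)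
    (hQR : ∀ i, Q i ≤ R) (hR : R = Q true ⊔ Q false) (hSR : S ≤ R)
    (hT : (bassSerre Q).IsAcyclic)
    (hp : ∀ i x x' y, R x y → S x x' → project S Q q i (x, y) = project S Q q i (x', y)) :
    (treeing R S (project S Q q) hp hSR).IsAcyclic := by
  refine isAcyclic_of_contraction hT (ProjectsTo R S Q q) (vertex Q none)
    (fun x w z z' => hq.projectsTo_unique hQR hR hSR) ?_ ?_
  · rintro x w z (⟨rfl, h⟩ | ⟨i, y, hy, rfl, rfl⟩)
    · exact Relation.ReflTransGen.refl
    · obtain ⟨n, hn⟩ := exists_near (S := S) hR hy i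
      exact (hq.reflTransGen_of_near hQR hR n i y hy hn).2
  · intro x z z' hxz hzz'
    have hS : S x z := by
      clear hzz'
      rw [SimpleGraph.reachable_iff_reflTransGen] at hxz
      induction hxz with
      | refl => exact S.refl x
      | tail _ h ih => exact S.trans ih h.2.1
    obtain ⟨hne, hS', (h | h) | ⟨y, hy, h⟩⟩ := hzz'
    · exact ⟨vertex Q none z, vertex Q (some true) z, bassSerre_adj z (by simp) (Or.inr rfl),
        Or.inl ⟨rfl, hS⟩, Or.inr ⟨true, z, hSR hS, rfl,
          (hp true x z z (hSR hS) hS).trans h⟩⟩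
    · have hS'' := S.trans hS hS'
      exact ⟨vertex Q (some true) z', vertex Q none z', bassSerre_adj z' (by simp) (Or.inl rfl),
        Or.inr ⟨true, z', hSR hS'', rfl, (hp true x z' z' (hSR hS'') hS'').trans h⟩,
        Or.inl ⟨rfl, hS''⟩⟩
    · have hxy : R x y := R.trans (hSR hS) hy
      rw [← hp true x z y hxy hS, ← hp false x z y hxy hS] at h
      rcases h with ⟨h1, h2⟩ | ⟨h1, h2⟩
      · exact ⟨vertex Q (some true) y, vertex Q (some false) y,
          bassSerre_adj y (by simp) (Or.inl rfl), Or.inr ⟨true, y, hxy, rfl, h1⟩,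
          Or.inr ⟨false, y, hxy, rfl, h2⟩⟩
      · exact ⟨vertex Q (some false) y, vertex Q (some true) y,
          bassSerre_adj y (by simp) (Or.inr rfl), Or.inr ⟨false, y, hxy, rfl, h2⟩,
          Or.inr ⟨true, y, hxy, rfl, h1⟩⟩

theorem IsStep.treeing_reachable_iff {q : Bool → X × X → X} (hq : IsStep R S Q q)
    (hQR : ∀ i, Q i ≤ R) (hR : R = Q true ⊔ Q false) (hSR : S ≤ R)
    (hp : ∀ i x x' y, R x y → S x x' → project S Q q i (x, y) = project S Q q i (x', y))
    (a b : X) : (treeing R S (project S Q q) hp hSR).Reachable a b ↔ S a b := by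
  set G := treeing R S (project S Q q) hp hSR
  constructor
  · intro h
    rw [SimpleGraph.reachable_iff_reflTransGen] at h
    induction h with
    | refl => exact S.refl a
    | tail _ h ih => exact S.trans ih h.2.1
  · intro hab
    have hpS : ∀ i y, R a y → S a (project S Q q i (a, y)) := fun i y => hq.rel_project hQR hR
    have hleaf : ∀ c, S a c → G.Reachable c (project S Q q true (a, c)) := by
      intro c hc
      by_cases he : c = project S Q q true (a, c)
      · rw [← he]
      · refine SimpleGraph.Adj.reachable ⟨he, S.trans (S.symm hc) (hpS _ _ (hSR hc)), ?_⟩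
        exact Or.inl (Or.inl (hp true a c c (hSR hc) hc).symm)
    have hsides : ∀ y, R a y →
        G.Reachable (project S Q q true (a, y)) (project S Q q false (a, y)) := by
      intro y hy
      by_cases he : project S Q q true (a, y) = project S Q q false (a, y)
      · rw [he]
      · have h1 := hpS true y hy
        refine SimpleGraph.Adj.reachable ⟨he, S.trans (S.symm h1) (hpS _ _ hy), ?_⟩
        refine Or.inr ⟨y, R.trans (R.symm (hSR h1)) hy, Or.inl ⟨?_, ?_⟩⟩
        · exact (hp true a _ y hy h1).symm
        · exact (hp false a _ y hy h1).symm
    -- Both generators preserve the component of the projection: `Q true` fixes the projection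
    -- itself, and `Q false` moves it through the `false` side.
    let E : Setoid X :=
      { r := fun y y' => (R a y ↔ R a y') ∧ (R a y → R a y' →
          G.Reachable (project S Q q true (a, y)) (project S Q q true (a, y')))
        iseqv :=
          { refl := fun y => ⟨Iff.rfl, fun _ _ => SimpleGraph.Reachable.refl _⟩
            symm := fun h => ⟨h.1.symm, fun h1 h2 => (h.2 h2 h1).symm⟩
            trans := fun h h' => ⟨h.1.trans h'.1, fun h1 h3 =>
              (h.2 h1 (h.1.1 h1)).trans (h'.2 (h.1.1 h1) h3)⟩ } }
    have hE : ∀ i, Q i ≤ E := by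
      intro i y y' hy
      refine ⟨⟨fun h => R.trans h (hQR i hy), fun h => R.trans h (R.symm (hQR i hy))⟩, ?_⟩
      intro h1 h2
      have he := hq.project_congr hQR hR hSR h1 (S.refl a) hy
      cases i
      · refine (hsides y h1).trans ?_
        rw [he]
        exact (hsides y' h2).symm
      · rw [he]
    have hRE : R ≤ E := by
      rw [hR]
      exact sup_le (hE true) (hE false)
    exact (hleaf a (S.refl a)).trans (((hRE (hSR hab)).2 (R.refl a) (hSR hab)).trans
      (hleaf b hab).symm)

end Projection

/-! ### Borel measurability and construction of the step functions -/

section Measurability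

variable {X : Type*} [MeasurableSpace X] {R S : Setoid X} {Q : Bool → Setoid X} {f : ℕ → X → X}

theorem IsEnumeration.measurable_near (hf : IsEnumeration R f) (hS : IsBorel S)
    (hQ : ∀ i, IsBorel (Q i)) (hSR : S ≤ R) (hQR : ∀ i, Q i ≤ R) (n : ℕ) (i : Bool) :
    Measurable fun p : X × X => Near S Q n i p.1 p.2 := by
  induction n generalizing i with
  | zero =>
    refine Measurable.and measurable_const (hf.measurable_exists measurable_fst ?_ ?_)
    · exact (hS.measurable_rel (measurable_fst.comp measurable_fst) measurable_snd).and
        ((hQ i).measurable_rel (measurable_snd.comp measurable_fst) measurable_snd)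
    · exact fun z q h => hSR h.1
  | succ n ih =>
    refine (ih i).or (hf.measurable_exists measurable_snd ?_ ?_)
    · exact ((hQ i).measurable_rel (measurable_snd.comp measurable_fst) measurable_snd).and
        ((ih (!i)).comp ((measurable_fst.comp measurable_fst).prodMk measurable_snd))
    · exact fun z q h => hQR i h.1

theorem measurable_flow (hS : IsBorel S) {q : Bool → X × X → X} (hq : ∀ i, Measurable (q i))
    (n : ℕ) (i : Bool) : Measurable fun p : X × X => flow S q n i p.1 p.2 := by
  classical
  induction n generalizing i with
  | zero => exact hq i
  | succ n ih =>
    simp only [flow]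
    refine Measurable.ite (measurableSet_setOfPred.2 (measurable_const.and
      (hS.measurable_rel measurable_fst (hq i)))) (hq i) ?_
    exact (ih (!i)).comp (measurable_fst.prodMk (hq i))

theorem IsEnumeration.measurable_project (hf : IsEnumeration R f) (hS : IsBorel S)
    (hQ : ∀ i, IsBorel (Q i)) (hSR : S ≤ R) (hQR : ∀ i, Q i ≤ R) {q : Bool → X × X → X}
    (hq : ∀ i, Measurable (q i)) (i : Bool) : Measurable (project S Q q i) := by
  classical
  have hN := hf.measurable_near hS hQ hSR hQR
  have hF := measurable_flow hS hq
  have hex : MeasurableSet {z : X × X | ∃ n, Near S Q n i z.1 z.2} :=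
    measurableSet_setOfPred.2 (Measurable.exists fun n => hN n i)
  let P : ℕ → X × X → Prop := fun n z => Near S Q n i z.1 z.2 ∨ ¬ ∃ n, Near S Q n i z.1 z.2
  have hP : ∀ z, ∃ n, P n z := by
    intro z
    by_cases h : ∃ n, Near S Q n i z.1 z.2
    · exact h.imp fun n => Or.inl
    · exact ⟨0, Or.inr h⟩
  have hfind : Measurable fun z => flow S q (Nat.find (hP z)) i z.1 z.2 :=
    Measurable.find (f := fun n z => flow S q n i z.1 z.2) (p := P) (fun n => hF n i)
      (fun n => (measurableSet_setOfPred.2 (hN n i)).union hex.compl) hP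
  have hite := @Measurable.ite _ _ _ _ _ _ _ (fun _ => Classical.propDecidable _) hex hfind
    measurable_fst
  convert hite using 1
  ext z
  simp only [project]
  split_ifs with h
  · congr 1
    have : ∀ n, P n z ↔ Near S Q n i z.1 z.2 := fun n => by simp [P, h]
    simp only [this]
  · rfl

theorem IsEnumeration.exists_isStep [StandardBorelSpace X] (hf : IsEnumeration R f)
    (hR : IsBorel R) (hS : IsBorel S) (hQ : ∀ i, IsBorel (Q i)) (hSR : S ≤ R)
    (hQR : ∀ i, Q i ≤ R) (hsup : R = Q true ⊔ Q false)
    (hsm : ∀ i, ∀ φ : PartialEquiv X X, MemFullPseudogroup R φ →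
      IsSmooth (conj φ (Q i) ⊓ restrict S φ.source)) :
    ∃ q : Bool → X × X → X, (∀ i, Measurable (q i)) ∧ IsStep R S Q q := by
  choose σ hσm hσS hσ using fun i => hf.exists_selector (hQ i) hS hSR (hsm i)
  have hN := hf.measurable_near hS hQ hSR hQR
  -- Admissible next points `t`: either an exit, or a point whose other class satisfies a distance
  -- bound that the present class fails.
  let A : Bool → X × X → X → Prop := fun i z t => R z.1 z.2 ∧ Q i z.2 t ∧ ((i = true ∧ S z.1 t) ∨
    ∃ n, Near S Q n (!i) z.1 t ∧ ¬ Near S Q n i z.1 z.2)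
  have hAm : ∀ i, Measurable fun p : (X × X) × X => A i p.1 p.2 := by
    intro i
    have h11 : Measurable fun p : (X × X) × X => p.1.1 := measurable_fst.comp measurable_fst
    have h12 : Measurable fun p : (X × X) × X => p.1.2 := measurable_snd.comp measurable_fst
    refine (hR.measurable_rel h11 h12).and (((hQ i).measurable_rel h12 measurable_snd).and
      ((measurable_const.and (hS.measurable_rel h11 measurable_snd)).or
      (Measurable.exists fun n => ?_)))
    exact ((hN n (!i)).comp (h11.prodMk measurable_snd)).and ((hN n i).comp measurable_fst).not
  have hAR : ∀ i z t, A i z t → R z.1 t := fun i z t h => R.trans h.1 (hQR i h.2.1)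
  choose F hFm hFA hFcongr using
    fun i => hf.exists_uniformization measurable_fst (hAm i) (hAR i)
  have hex : ∀ i s y, R s y → ∃ t, A i (s, y) t := by
    intro i s y hsy
    obtain ⟨n, hn⟩ := exists_near (S := S) hsup hsy i
    induction n with
    | zero =>
      obtain ⟨hi, t, h1, h2⟩ := hn
      exact ⟨t, hsy, h2, Or.inl ⟨hi, h1⟩⟩
    | succ n ih =>
      by_cases h : Near S Q n i s y
      · exact ih h
      · obtain ⟨t, h1, h2⟩ := hn.resolve_left h
        exact ⟨t, hsy, h1, Or.inr ⟨n, h2, h⟩⟩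
  have hσR : ∀ i x y, R x y → R (σ i (x, y)) y := fun i x y hxy =>
    R.trans (R.symm (hSR (hσS i x y hxy))) hxy
  have hspec : ∀ i x y, R x y → A i (σ i (x, y), y) (F i (σ i (x, y), y)) :=
    fun i x y hxy => hFA i _ (hex i _ y (hσR i x y hxy))
  -- `F` depends on its base point and the admissible set; using `σ i z` as base point instead of
  -- `z.1` removes the dependence on representatives.
  refine ⟨fun i z => F i (σ i z, z.2), fun i => (hFm i).comp ((hσm i).prodMk measurable_snd),
    ⟨fun i x y hxy => (hspec i x y hxy).2.1, ?_, ?_, ?_⟩⟩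
  · intro i x y hxy h
    have hS' := hσS i x y hxy
    rcases (hspec i x y hxy).2.2 with ⟨h1, h2⟩ | ⟨n, -, h2⟩
    · exact ⟨h1, S.trans hS' h2⟩
    · exact absurd ((h.mono (Nat.zero_le n)).congr hS' ((Q i).refl y)) h2
  · intro n i x y hxy h
    have hS' := hσS i x y hxy
    rcases (hspec i x y hxy).2.2 with ⟨h1, h2⟩ | ⟨m, h1, h2⟩
    · exact Or.inl ⟨h1, S.trans hS' h2⟩
    -- The current class fails the bound `m` but satisfies `n + 1`.
    · have hmn : m ≤ n := by
        by_contra hlt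
        exact h2 ((h.mono (show n + 1 ≤ m by omega)).congr hS' ((Q i).refl y))
      exact Or.inr ((h1.mono hmn).congr (S.symm hS') ((Q _).refl _))
  · intro i x x' y y' hxy hxy' hx hy
    have hs := hσ i x x' y y' hxy hxy' hx hy
    have h1 := hσR i x y hxy
    change F i (σ i (x, y), y) = F i (σ i (x', y'), y')
    rw [← hs]
    refine hFcongr i _ _ rfl fun t => and_congr ?_ (and_congr ?_ (or_congr Iff.rfl ?_))
    · exact ⟨fun h => R.trans h (hQR i hy), fun h => R.trans h (R.symm (hQR i hy))⟩
    · exact ⟨fun h => (Q i).trans ((Q i).symm hy) h, fun h => (Q i).trans hy h⟩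
    · refine exists_congr fun n => and_congr Iff.rfl (not_congr ?_)
      exact ⟨fun h => h.congr (S.refl _) hy, fun h => h.congr (S.refl _) ((Q i).symm hy)⟩

theorem IsEnumeration.measurableSet_treeing [StandardBorelSpace X] (hf : IsEnumeration R f)
    (hR : IsBorel R) (hS : IsBorel S) (hSR : S ≤ R) {p : Bool → X × X → X}
    (hp : ∀ i x x' y, R x y → S x x' → p i (x, y) = p i (x', y))
    (hpm : ∀ i, Measurable (p i)) :
    MeasurableSet {z : X × X | (treeing R S p hp hSR).Adj z.1 z.2} := by
  have heq : ∀ {Z : Type _} [MeasurableSpace Z] {a b : Z → X}, Measurable a → Measurable b →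
      Measurable fun z => a z = b z := fun ha hb =>
    measurableSet_setOfPred.1 (measurableSet_eq_fun ha hb)
  have h1 : Measurable fun z : X × X => z.1 := measurable_fst
  have h2 : Measurable fun z : X × X => z.2 := measurable_snd
  refine measurableSet_setOfPred.2 ((heq h1 h2).not.and ((hS.measurable_rel h1 h2).and
    (((heq ((hpm true).comp (h1.prodMk h1)) h2).or (heq ((hpm true).comp (h2.prodMk h2)) h1)).or
    (hf.measurable_exists h1 ?_ fun z y h => h.1))))
  have h11 : Measurable fun p : (X × X) × X => p.1.1 := measurable_fst.comp measurable_fst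
  have h12 : Measurable fun p : (X × X) × X => p.1.2 := measurable_snd.comp measurable_fst
  have hpy : ∀ i, Measurable fun z : (X × X) × X => p i (z.1.1, z.2) := fun i =>
    (hpm i).comp (h11.prodMk measurable_snd)
  exact (hR.measurable_rel h11 measurable_snd).and
    (((heq (hpy true) h11).and (heq (hpy false) h12)).or
      ((heq (hpy true) h12).and (heq (hpy false) h11)))

end Measurability

end BorelRel

/-! ### The treeing of `S` -/

theorem proposition29 {X : Type*} [MeasurableSpace X] [StandardBorelSpace X]
    (R R₁ R₂ R₃ S : Setoid X)
    (hR : BorelRel.IsBorel R) (hRc : BorelRel.HasCountableClasses R)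
    (hR₁ : BorelRel.IsBorel R₁) (hR₂ : BorelRel.IsBorel R₂) (hR₃ : BorelRel.IsBorel R₃)
    (hamalgam : BorelRel.IsAmalgam R R₁ R₂ R₃)
    (hS : BorelRel.IsBorel S) (hSR : S ≤ R)
    (hsmooth : ∀ φ : PartialEquiv X X, BorelRel.MemFullPseudogroup R φ →
      BorelRel.IsSmooth (BorelRel.conj φ R₁ ⊓ BorelRel.restrict S φ.source) ∧
      BorelRel.IsSmooth (BorelRel.conj φ R₂ ⊓ BorelRel.restrict S φ.source)) :
    BorelRel.IsTreeable S := by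
  let Q : Bool → Setoid X := fun i => if i then R₁ else R₂
  have hsup : R = Q true ⊔ Q false := hamalgam.generated
  have hQR : ∀ i, Q i ≤ R := by
    rw [hsup]
    exact Bool.forall_bool.2 ⟨le_sup_right, le_sup_left⟩
  have hQ : ∀ i, BorelRel.IsBorel (Q i) := Bool.forall_bool.2 ⟨hR₂, hR₁⟩
  obtain ⟨f, hf₁, hf₂, hf₃⟩ := BorelRel.exists_enumeration hR hRc
  have hf : BorelRel.IsEnumeration R f := ⟨hf₁, hf₂, hf₃⟩
  obtain ⟨q, hqm, hq⟩ := hf.exists_isStep hR hS hQ hSR hQR hsup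
    (Bool.forall_bool.2 ⟨fun φ hφ => (hsmooth φ hφ).2, fun φ hφ => (hsmooth φ hφ).1⟩)
  have hp : ∀ i x x' y, R x y → S x x' →
      BorelRel.project S Q q i (x, y) = BorelRel.project S Q q i (x', y) :=
    fun i x x' y hxy hx => hq.project_congr hQR hsup hSR hxy hx ((Q i).refl y)
  have hT : (BorelRel.bassSerre Q).IsAcyclic :=
    BorelRel.bassSerre_isAcyclic (R₃ := R₃) (Bool.forall_bool.2 ⟨hamalgam.le₂, hamalgam.le₁⟩)
      hamalgam.reduced_not_closed
  exact ⟨BorelRel.treeing R S (BorelRel.project S Q q) hp hSR,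
    hf.measurableSet_treeing hR hS hSR hp (hf.measurable_project hS hQ hSR hQR hqm),
    hq.treeing_isAcyclic hQR hsup hSR hT hp, hq.treeing_reachable_iff hQR hsup hSR hp⟩
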